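/- Let $n\ge 1$ be an integer. For $r\ge 1$ let $\mathcal H_r$ denote the set of all $(n-1)$-dimensional linear subspaces of $\mathbb R^n$ (hyperplanes through $0$) which contain $n-1$ linearly independent points of the integer lattice $\mathbb Z^n$ from the closed Euclidean ball of radius $r$ centered at the origin. Then there exist constants $c_1,c_2>0$, depending only on $n$, such that for all sufficiently large real $r$ (that is, for all $r\ge R$, where $R$ depends only on $n$) the set $\mathcal H_r$ is finite and $$c_1 r^{n(n-1)}\le |\mathcal H_r|\le c_2 r^{n(n-1)}.$$ -/

import Mathlib

/-- The integer lattice `ℤⁿ` inside Euclidean space `ℝⁿ`. -/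
def integerLattice (n : ℕ) : Set (EuclideanSpace ℝ (Fin n)) :=
  {x | ∀ i, ∃ m : ℤ, x i = (m : ℝ)}

/-- The set of all `(n - 1)`-dimensional linear subspaces of `ℝⁿ` that contain `n - 1` linearly
independent lattice points from the closed ball of radius `r` centered at the origin. -/
def latticeHyperplanes (n : ℕ) (r : ℝ) : Set (Submodule ℝ (EuclideanSpace ℝ (Fin n))) :=
  {H | Module.finrank ℝ H + 1 = n ∧
    ∃ v : Fin (n - 1) → EuclideanSpace ℝ (Fin n),
      LinearIndependent ℝ v ∧
        ∀ i, v i ∈ H ∧ v i ∈ integerLattice n ∧ v i ∈ Metric.closedBall 0 r}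

/-!
The upper bound is immediate: such a hyperplane is the span of `n - 1` of the `O(r ^ n)` lattice
points of the ball.

For the lower bound, write `n = d + 1` with `d ≥ 1` and describe hyperplanes by integer normal
vectors `z`. With `M` a small constant multiple of `r`, let `z` range over the box `[-N, N]ⁿ` where
`N = A * M ^ d` and `A` is a large constant, so that there are about `r ^ (n * (n - 1))` candidates.
Call `z` good if it is orthogonal to no nonzero integer vector of the box `[-M, M]ⁿ`
(`NoShortOrthogonal`). Three facts combine in `pow_le_mul_ncard_latticeHyperplanes`.

* Most `z` are good (`card_not_noShortOrthogonal_le`). A primitive `v` with largest coordinate `a`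
  is orthogonal to only `O(N ^ d / a)` vectors of the box (`mul_card_orthogonal_le`); the factor
  `1 / a` makes the sum over all such `v` of order `M ^ d * N ^ d = N ^ n / A`.
* If `z` is good, then `zᗮ` is one of the hyperplanes to be counted
  (`NoShortOrthogonal.orthogonal_mem_latticeHyperplanes`). By pigeonhole
  (`exists_large_fiber`), many lattice points of a box of side `K * M` have the same inner product
  with `z`. Their differences are lattice vectors of `zᗮ` of length `O(r)`, and since `z` is good
  they have length at least `M`. If those vectors spanned a space of dimension less than `d`, the
  volume packing bound (`card_le_of_separated`) would allow only `O(K ^ (d - 1))` points,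
  whereas pigeonhole gives at least a constant times `K ^ d`.
* A hyperplane arises from boundedly many good `z` (`card_le_of_orthogonal_eq`): the difference
  of two of them is again good, hence, by pigeonhole, of length at least a constant times `N`, while
  all of them lie on one line in a ball of radius `O(N)`.
-/

open Module Metric MeasureTheory
open scoped ENNReal

/-! ### Integer vectors in Euclidean space -/

/-- The integer vector `x`, viewed in Euclidean space. -/
def toEuc {n : ℕ} (x : Fin n → ℤ) : EuclideanSpace ℝ (Fin n) := WithLp.toLp 2 fun i => (x i : ℝ)

lemma toEuc_apply {n : ℕ} (x : Fin n → ℤ) (i : Fin n) : toEuc x i = x i := rfl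

lemma toEuc_injective {n : ℕ} : Function.Injective (toEuc (n := n)) := fun x y h => by
  ext i
  have := congrArg (fun v : EuclideanSpace ℝ (Fin n) => v i) h
  simpa [toEuc_apply] using this

lemma toEuc_sub {n : ℕ} (x y : Fin n → ℤ) : toEuc (x - y) = toEuc x - toEuc y := by
  ext i; simp [toEuc_apply]

lemma toEuc_zero {n : ℕ} : toEuc (0 : Fin n → ℤ) = 0 := by
  ext i; simp [toEuc_apply]

lemma toEuc_mem_integerLattice {n : ℕ} (x : Fin n → ℤ) : toEuc x ∈ integerLattice n :=
  fun i => ⟨x i, rfl⟩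

lemma exists_toEuc_eq {n : ℕ} {v : EuclideanSpace ℝ (Fin n)} (hv : v ∈ integerLattice n) :
    ∃ x, toEuc x = v := by
  choose x hx using hv
  exact ⟨x, by ext i; rw [toEuc_apply, hx]⟩

lemma inner_toEuc {n : ℕ} (x y : Fin n → ℤ) :
    inner ℝ (toEuc x) (toEuc y) = ((x ⬝ᵥ y : ℤ) : ℝ) := by
  simp [PiLp.inner_apply, dotProduct, toEuc_apply, mul_comm]

lemma abs_apply_le_norm_toEuc {n : ℕ} (x : Fin n → ℤ) (i : Fin n) :
    (|x i| : ℝ) ≤ ‖toEuc x‖ := by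
  have := PiLp.norm_apply_le (toEuc x) i
  simpa [toEuc_apply] using this

lemma norm_toEuc_le {n : ℕ} {x : Fin n → ℤ} {N : ℕ} (hx : ∀ i, |x i| ≤ N) :
    ‖toEuc x‖ ≤ n * N := by
  have h : toEuc x = ∑ i, EuclideanSpace.single i (x i : ℝ) := by
    ext j; simp [toEuc_apply, Finset.sum_apply]
  rw [h]
  refine (norm_sum_le _ _).trans ?_
  calc ∑ i : Fin n, ‖EuclideanSpace.single i (x i : ℝ)‖ ≤ ∑ i : Fin n, (N : ℝ) :=
        Finset.sum_le_sum fun i _ => by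
          simpa using (by exact_mod_cast hx i : (|x i| : ℝ) ≤ N)
    _ = n * N := by simp

/-! ### Packing bounds -/

/-- A finite subset of a ball of radius `R` in a `d`-dimensional normed space whose points are at
mutual distance at least `δ` has at most `(1 + 2R/δ) ^ d` points: the balls of radius `δ/2` around
them are disjoint and lie in a ball of radius `R + δ/2`. -/
theorem card_le_of_separated {E : Type*} [NormedAddCommGroup E] [NormedSpace ℝ E]
    [FiniteDimensional ℝ E] {R δ : ℝ} (hδ : 0 < δ) (hR : 0 ≤ R) (s : Finset E)
    (hs : ∀ c ∈ s, ‖c‖ ≤ R) (h : ∀ c ∈ s, ∀ d ∈ s, c ≠ d → δ ≤ ‖c - d‖) :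
    (s.card : ℝ) ≤ (1 + 2 * R / δ) ^ finrank ℝ E := by
  borelize E
  let μ : Measure E := Measure.addHaar
  have hρ : 0 < R + δ / 2 := by positivity
  have hδ' : 0 < δ / 2 := by positivity
  have D : Set.Pairwise (s : Set E) (Function.onFun Disjoint fun c => ball (c : E) (δ / 2)) := by
    rintro c hc d hd hcd
    apply ball_disjoint_ball
    rw [dist_eq_norm, add_halves]
    exact h c hc d hd hcd
  have hsub : (⋃ c ∈ s, ball (c : E) (δ / 2)) ⊆ ball (0 : E) (R + δ / 2) := by
    refine Set.iUnion₂_subset fun x hx => ball_subset_ball' ?_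
    rw [dist_zero_right]
    linarith [hs x hx]
  have I : (s.card : ℝ≥0∞) * ENNReal.ofReal ((δ / 2) ^ finrank ℝ E) * μ (ball 0 1) ≤
      ENNReal.ofReal ((R + δ / 2) ^ finrank ℝ E) * μ (ball 0 1) :=
    calc
      _ = μ (⋃ c ∈ s, ball (c : E) (δ / 2)) := by
        rw [measure_biUnion_finset D fun c _ => measurableSet_ball]
        simp only [μ.addHaar_ball_of_pos _ hδ', Finset.sum_const, nsmul_eq_mul, mul_assoc]
      _ ≤ μ (ball (0 : E) (R + δ / 2)) := measure_mono hsub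
      _ = _ := μ.addHaar_ball_of_pos _ hρ
  have J : (s.card : ℝ≥0∞) * ENNReal.ofReal ((δ / 2) ^ finrank ℝ E) ≤
      ENNReal.ofReal ((R + δ / 2) ^ finrank ℝ E) :=
    (ENNReal.mul_le_mul_iff_left (measure_ball_pos _ _ zero_lt_one).ne' measure_ball_lt_top.ne).1 I
  have K := ENNReal.toReal_le_of_le_ofReal (pow_nonneg hρ.le _) J
  rw [ENNReal.toReal_mul, ENNReal.toReal_ofReal (by positivity), ENNReal.toReal_natCast] at K
  have e : 1 + 2 * R / δ = (R + δ / 2) / (δ / 2) := by field_simp; ring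
  rw [e, div_pow, le_div_iff₀ (by positivity)]
  exact K

/-- The packing bound for points in a translate of the subspace `W`. -/
theorem card_le_of_separated_of_sub_mem {E : Type*} [NormedAddCommGroup E] [NormedSpace ℝ E]
    (W : Submodule ℝ E) [FiniteDimensional ℝ W] {R δ : ℝ} (hδ : 0 < δ) (hR : 0 ≤ R) (s : Finset E)
    (hW : ∀ c ∈ s, ∀ d ∈ s, c - d ∈ W) (hs : ∀ c ∈ s, ∀ d ∈ s, ‖c - d‖ ≤ R)
    (h : ∀ c ∈ s, ∀ d ∈ s, c ≠ d → δ ≤ ‖c - d‖) :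
    (s.card : ℝ) ≤ (1 + 2 * R / δ) ^ finrank ℝ W := by
  classical
  rcases s.eq_empty_or_nonempty with rfl | ⟨p, hp⟩
  · simp only [Finset.card_empty, Nat.cast_zero]; positivity
  let f : s → W := fun c => ⟨c - p, hW c c.2 p hp⟩
  have hf : Function.Injective f := fun c d hcd => by
    have e : (c : E) - p = d - p := congrArg Subtype.val hcd
    exact Subtype.ext (sub_left_injective e)
  rw [← Finset.card_attach, ← Finset.card_image_of_injective _ hf]
  refine card_le_of_separated hδ hR _ ?_ ?_
  · simp only [Finset.mem_image, forall_exists_index, and_imp]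
    rintro _ c - rfl
    exact hs c c.2 p hp
  · simp only [Finset.mem_image, forall_exists_index, and_imp]
    rintro _ c - rfl _ d - rfl hcd
    have := h c c.2 d d.2 fun e => hcd (by rw [Subtype.ext e])
    simpa [f] using this

/-! ### Pigeonhole principle for linear forms on a box -/

/-- By the pigeonhole principle, some value of the linear form `x ↦ z ⬝ᵥ x` is taken on many points
of the box `[0, L]ⁿ`. -/
theorem exists_large_fiber {n N L : ℕ} {z : Fin n → ℤ} (hz : ∀ i, |z i| ≤ N) :
    ∃ T : Finset (Fin n → ℤ), (∀ x ∈ T, ∀ i, 0 ≤ x i ∧ x i ≤ L) ∧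
      (∀ x ∈ T, ∀ y ∈ T, z ⬝ᵥ x = z ⬝ᵥ y) ∧ (L + 1) ^ n ≤ (2 * n * N * L + 1) * T.card := by
  classical
  set B : Finset (Fin n → ℤ) := Fintype.piFinset fun _ => Finset.Icc (0 : ℤ) L with hB
  set V : Finset ℤ := Finset.Icc (-(n * N * L : ℤ)) (n * N * L) with hV
  have hmaps : (B : Set (Fin n → ℤ)).MapsTo (fun x => z ⬝ᵥ x) V := by
    intro x hx
    simp only [hB, Finset.mem_coe, Fintype.mem_piFinset, Finset.mem_Icc] at hx
    simp only [hV, Finset.coe_Icc, Set.mem_Icc, ← abs_le]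
    calc |z ⬝ᵥ x| ≤ ∑ i, |z i * x i| := Finset.abs_sum_le_sum_abs _ _
      _ ≤ ∑ i : Fin n, (N * L : ℤ) := Finset.sum_le_sum fun i _ => by
          rw [abs_mul, abs_of_nonneg (hx i).1]
          exact mul_le_mul (hz i) (hx i).2 (hx i).1 (by positivity)
      _ = n * N * L := by simp [mul_assoc]
  have hVne : V.Nonempty := ⟨0, by
    simp only [hV, Finset.mem_Icc, Left.neg_nonpos_iff]
    constructor <;> positivity⟩
  obtain ⟨b, -, hb⟩ := V.exists_max_image (fun b => (B.filter fun x => z ⬝ᵥ x = b).card) hVne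
  refine ⟨B.filter fun x => z ⬝ᵥ x = b, ?_, ?_, ?_⟩
  · intro x hx i
    have := (Finset.mem_filter.1 hx).1
    simp only [hB, Fintype.mem_piFinset, Finset.mem_Icc] at this
    exact this i
  · intro x hx y hy
    rw [(Finset.mem_filter.1 hx).2, (Finset.mem_filter.1 hy).2]
  · have hBc : B.card = (L + 1) ^ n := by
      simp [hB]
    have hVc : V.card = 2 * n * N * L + 1 := by
      rw [hV, Int.card_Icc]
      have : (n * N * L : ℤ) + 1 - -(n * N * L) = ((2 * n * N * L + 1 : ℕ) : ℤ) := by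
        push_cast; ring
      rw [this, Int.toNat_natCast]
    rw [← hBc, ← hVc, Finset.card_eq_sum_card_fiberwise hmaps, ← smul_eq_mul]
    exact Finset.sum_le_card_nsmul _ _ _ hb

/-! ### Most integer vectors are orthogonal to no short vector -/

/-- If `v` is primitive and `v j = a > 0`, then at most `(3N)ᵈ / a` points of the box `[-N, N]ᵈ⁺¹`
are orthogonal to `v`: choosing for each residue `s` modulo `a` a small vector `u` with
`v ⬝ᵥ u ≡ s` and `u j = 0`, the translates of the set of these points by the `a` vectors `u`,
projected along the `j`-th coordinate, are disjoint. -/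
lemma mul_card_orthogonal_le {d N a : ℕ} {v : Fin (d + 1) → ℤ} {j : Fin (d + 1)}
    (hv : ∃ u, v ⬝ᵥ u = 1) (hj : v j = a) (ha : 1 ≤ a) (haN : a ≤ N) :
    a * ((Fintype.piFinset fun _ => Finset.Icc (-N : ℤ) N).filter fun z => z ⬝ᵥ v = 0).card ≤
      (3 * N) ^ d := by
  classical
  obtain ⟨u, hu⟩ := hv
  have ha' : (0 : ℤ) < a := by exact_mod_cast ha
  set F := (Fintype.piFinset fun _ => Finset.Icc (-N : ℤ) N).filter
    fun z : Fin (d + 1) → ℤ => z ⬝ᵥ v = 0 with hF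
  have memF : ∀ z ∈ F, (∀ i, -(N : ℤ) ≤ z i ∧ z i ≤ N) ∧ v ⬝ᵥ z = 0 := fun z hz => by
    simp only [hF, Finset.mem_filter, Fintype.mem_piFinset, Finset.mem_Icc] at hz
    exact ⟨hz.1, by rw [dotProduct_comm, hz.2]⟩
  let B : Finset (Fin (d + 1) → ℤ) :=
    Fintype.piFinset fun i => if i = j then {0} else Finset.Ico (-N : ℤ) (2 * N)
  have hB : B.card = (3 * N) ^ d := by
    have h2 : ∀ i : Fin d, (if j.succAbove i = j then ({0} : Finset ℤ) else
        Finset.Ico (-N : ℤ) (2 * N)).card = 3 * N := fun i => by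
      rw [if_neg (Fin.succAbove_ne j i), Int.card_Ico]
      omega
    simp only [B]
    rw [Fintype.card_piFinset, Fin.prod_univ_succAbove _ j]
    simp only [h2]
    simp
  let g : ℕ × (Fin (d + 1) → ℤ) → Fin (d + 1) → ℤ := fun p i =>
    if i = j then 0 else p.2 i + (p.1 * u i) % a
  -- The residue `s` can be read off from the projected translate.
  have key : ∀ s : ℕ, ∀ z ∈ F, (a : ℤ) ∣ s - v ⬝ᵥ g (s, z) := by
    intro s z hz
    have e : (s : ℤ) - v ⬝ᵥ g (s, z) = ∑ i, v i * (z i + s * u i - g (s, z) i) := by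
      have h1 : v ⬝ᵥ (z + (s : ℤ) • u - g (s, z)) = s - v ⬝ᵥ g (s, z) := by
        rw [dotProduct_sub, dotProduct_add, dotProduct_smul, hu, (memF z hz).2]
        simp
      rw [← h1]
      simp [dotProduct]
    rw [e]
    refine Finset.dvd_sum fun i _ => ?_
    by_cases hi : i = j
    · rw [hi, hj]; exact dvd_mul_right _ _
    · refine Dvd.dvd.mul_left ?_ _
      simp only [g, if_neg hi, add_sub_add_left_eq_sub]
      exact Int.dvd_self_sub_emod
  rw [← hB, ← Finset.card_range a, ← Finset.card_product]
  refine Finset.card_le_card_of_injOn g ?_ ?_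
  · rintro ⟨s, z⟩ hp
    simp only [Finset.coe_product, Set.mem_prod, Finset.mem_coe] at hp
    simp only [B, Finset.mem_coe, Fintype.mem_piFinset]
    intro i
    by_cases hi : i = j
    · simp [g, hi]
    · have h1 := (memF z hp.2).1 i
      have h2 := Int.emod_nonneg ((s : ℤ) * u i) ha'.ne'
      have h3 := Int.emod_lt_of_pos ((s : ℤ) * u i) ha'
      simp only [g, if_neg hi, Finset.mem_Ico]
      omega
  · rintro ⟨s, z⟩ hp ⟨s', z'⟩ hp' hg
    simp only [Finset.coe_product, Set.mem_prod, Finset.mem_coe, Finset.mem_range] at hp hp'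
    have k := key s z hp.2
    rw [hg] at k
    have k' := dvd_sub k (key s' z' hp'.2)
    rw [sub_sub_sub_cancel_right] at k'
    have hs : s = s' := by
      have h0 := Int.eq_zero_of_abs_lt_dvd k' (by rw [abs_lt]; omega)
      omega
    subst hs
    have hz : ∀ i, i ≠ j → z i = z' i := fun i hi => by
      have := congrFun hg i
      simpa [g, hi] using this
    -- The projection forgets `z j`, which is recovered from `v ⬝ᵥ z = 0`.
    have hzj : v j * (z j - z' j) = 0 := by
      have h1 : v ⬝ᵥ (z - z') = 0 := by
        rw [dotProduct_sub, (memF z hp.2).2, (memF z' hp'.2).2, sub_zero]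
      rw [← h1, dotProduct, Finset.sum_eq_single j]
      · simp
      · intro i _ hi
        simp [hz i hi]
      · simp
    have hzz : z = z' := by
      ext i
      by_cases hi : i = j
      · rw [hj] at hzj
        have := (mul_eq_zero.1 hzj).resolve_left ha'.ne'
        rw [hi]; omega
      · exact hz i hi
    rw [hzz]

/-- Every nonzero integer vector is a multiple of a primitive one, which up to sign has a positive
coordinate of largest absolute value. -/
lemma exists_primitive {n M : ℕ} {v z : Fin n → ℤ} (hv : v ≠ 0) (hM : ∀ i, |v i| ≤ M)
    (hz : z ⬝ᵥ v = 0) :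
    ∃ (j : Fin n) (a : ℕ) (w : Fin n → ℤ), 1 ≤ a ∧ a ≤ M ∧ w j = a ∧ (∀ i, |w i| ≤ a) ∧
      (∃ u, w ⬝ᵥ u = 1) ∧ z ⬝ᵥ w = 0 := by
  obtain ⟨i₀, hi₀⟩ := Function.ne_iff.1 hv
  obtain ⟨w, hw, hw1⟩ := Finset.extract_gcd v ⟨i₀, Finset.mem_univ i₀⟩
  set g := Finset.univ.gcd v
  have hvw : v = g • w := by ext i; simpa using hw i (Finset.mem_univ i)
  have hg : g ≠ 0 := fun h => hv (by rw [hvw, h, zero_smul])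
  have hzw : z ⬝ᵥ w = 0 := by
    rw [hvw, dotProduct_smul, smul_eq_mul] at hz
    exact (mul_eq_zero.1 hz).resolve_left hg
  have hwM : ∀ i, |w i| ≤ M := fun i => by
    refine le_trans ?_ (hM i)
    rw [hw i (Finset.mem_univ i), abs_mul]
    exact le_mul_of_one_le_left (abs_nonneg _) (Int.one_le_abs hg)
  obtain ⟨u, hu⟩ := Finset.gcd_eq_sum_mul Finset.univ w
  rw [hw1] at hu
  obtain ⟨j, -, hj⟩ := Finset.exists_max_image Finset.univ (fun i => |w i|) ⟨i₀, Finset.mem_univ i₀⟩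
  have hwj : w j ≠ 0 := fun h => by
    refine hi₀ ?_
    have := hj i₀ (Finset.mem_univ _)
    simp only [h, abs_zero, abs_nonpos_iff] at this
    simp [hvw, this]
  have hcast : ((w j).natAbs : ℤ) = |w j| := Int.natCast_natAbs _
  have h1 : 1 ≤ (w j).natAbs := Nat.one_le_iff_ne_zero.2 (Int.natAbs_ne_zero.2 hwj)
  have h2 : (w j).natAbs ≤ M := by exact_mod_cast hcast ▸ hwM j
  rcases le_total 0 (w j) with h | h
  · exact ⟨j, (w j).natAbs, w, h1, h2, by rw [hcast, abs_of_nonneg h],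
      fun i => by rw [hcast]; exact hj i (Finset.mem_univ _), ⟨u, hu.symm⟩, hzw⟩
  · refine ⟨j, (w j).natAbs, -w, h1, h2, by rw [hcast, abs_of_nonpos h]; rfl,
      fun i => ?_, ⟨-u, ?_⟩, ?_⟩
    · rw [hcast, Pi.neg_apply, abs_neg]; exact hj i (Finset.mem_univ _)
    · rw [neg_dotProduct_neg]; exact hu.symm
    · rw [dotProduct_neg, hzw, neg_zero]

/-- No nonzero integer vector in the box `[-M, M]ⁿ` is orthogonal to `z`. -/
def NoShortOrthogonal {n : ℕ} (M : ℕ) (z : Fin n → ℤ) : Prop :=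
  ∀ v : Fin n → ℤ, v ≠ 0 → (∀ i, |v i| ≤ M) → z ⬝ᵥ v ≠ 0

/-- A union bound over the primitive vectors of the box `[-M, M]ᵈ⁺¹`: the number of those with largest
coordinate `a` is `O(a ^ d)`, and each of them excludes `O(N ^ d / a)` vectors. -/
lemma card_not_noShortOrthogonal_le {d M N : ℕ} (hd : 1 ≤ d) (hMN : M ≤ N) [DecidablePred
    fun z : Fin (d + 1) → ℤ => NoShortOrthogonal M z] :
    ((Fintype.piFinset fun _ : Fin (d + 1) => Finset.Icc (-N : ℤ) N).filter
      fun z => ¬ NoShortOrthogonal M z).card ≤ ((d + 1) * 9 ^ d) * M ^ d * N ^ d := by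
  classical
  let F : (Fin (d + 1) → ℤ) → Finset (Fin (d + 1) → ℤ) := fun v =>
    (Fintype.piFinset fun _ => Finset.Icc (-N : ℤ) N).filter fun z => z ⬝ᵥ v = 0
  let V : Fin (d + 1) → ℕ → Finset (Fin (d + 1) → ℤ) := fun j a =>
    (Fintype.piFinset fun i => if i = j then {(a : ℤ)} else Finset.Icc (-a : ℤ) a).filter
      fun v => ∃ u, v ⬝ᵥ u = 1
  have hVcard : ∀ j a, (V j a).card ≤ (2 * a + 1) ^ d := fun j a => by
    refine (Finset.card_filter_le _ _).trans (le_of_eq ?_)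
    have h2 : ∀ i : Fin d, (if j.succAbove i = j then ({(a : ℤ)} : Finset ℤ) else
        Finset.Icc (-a : ℤ) a).card = 2 * a + 1 := fun i => by
      rw [if_neg (Fin.succAbove_ne j i), Int.card_Icc]
      omega
    rw [Fintype.card_piFinset, Fin.prod_univ_succAbove _ j]
    simp only [h2]
    simp
  have hU : ∀ j, ∀ a ∈ Finset.Icc 1 M, ((V j a).biUnion F).card ≤ 9 ^ d * M ^ (d - 1) * N ^ d := by
    intro j a ha
    obtain ⟨ha1, haM⟩ := Finset.mem_Icc.1 ha
    have h : a * ((V j a).biUnion F).card ≤ a * (9 ^ d * a ^ (d - 1) * N ^ d) :=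
      calc a * ((V j a).biUnion F).card ≤ a * ∑ v ∈ V j a, (F v).card :=
            Nat.mul_le_mul_left _ Finset.card_biUnion_le
        _ = ∑ v ∈ V j a, a * (F v).card := Finset.mul_sum _ _ _
        _ ≤ ∑ v ∈ V j a, (3 * N) ^ d := Finset.sum_le_sum fun v hv => by
            simp only [V, Finset.mem_filter, Fintype.mem_piFinset] at hv
            have hvj := hv.1 j
            simp only [if_true, Finset.mem_singleton] at hvj
            exact mul_card_orthogonal_le hv.2 hvj ha1 (haM.trans hMN)
        _ = (V j a).card * (3 * N) ^ d := by simp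
        _ ≤ (3 * a) ^ d * (3 * N) ^ d :=
            Nat.mul_le_mul_right _ ((hVcard j a).trans (Nat.pow_le_pow_left (by omega) d))
        _ = a * (9 ^ d * a ^ (d - 1) * N ^ d) := by
            obtain ⟨e, rfl⟩ := Nat.exists_eq_add_of_le' hd
            rw [show 9 = 3 * 3 from rfl, Nat.add_sub_cancel]
            simp only [mul_pow]
            ring
    refine (Nat.le_of_mul_le_mul_left h ha1).trans ?_
    gcongr
  have hsub : ((Fintype.piFinset fun _ : Fin (d + 1) => Finset.Icc (-N : ℤ) N).filter
      fun z => ¬ NoShortOrthogonal M z) ⊆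
      Finset.univ.biUnion fun j => (Finset.Icc 1 M).biUnion fun a => (V j a).biUnion F := by
    intro z hz
    obtain ⟨hzN, hz⟩ := Finset.mem_filter.1 hz
    unfold NoShortOrthogonal at hz
    push Not at hz
    obtain ⟨v, hv, hvM, hzv⟩ := hz
    obtain ⟨j, a, w, ha, haM, hwj, hwa, hwu, hzw⟩ := exists_primitive hv hvM hzv
    simp only [Finset.mem_biUnion, Finset.mem_univ, true_and, Finset.mem_Icc]
    refine ⟨j, a, ⟨ha, haM⟩, w, ?_, Finset.mem_filter.2 ⟨hzN, hzw⟩⟩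
    simp only [V, Finset.mem_filter, Fintype.mem_piFinset]
    refine ⟨fun i => ?_, hwu⟩
    by_cases hi : i = j
    · simp [hi, hwj]
    · simpa [hi, abs_le] using hwa i
  refine (Finset.card_le_card hsub).trans (Finset.card_biUnion_le.trans ?_)
  calc ∑ j : Fin (d + 1), ((Finset.Icc 1 M).biUnion fun a => (V j a).biUnion F).card
      ≤ ∑ j : Fin (d + 1), M * (9 ^ d * M ^ (d - 1) * N ^ d) := Finset.sum_le_sum fun j _ => by
        refine Finset.card_biUnion_le.trans ((Finset.sum_le_card_nsmul _ _ _ (hU j)).trans ?_)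
        simp
    _ = ((d + 1) * 9 ^ d) * M ^ d * N ^ d := by
        obtain ⟨e, rfl⟩ := Nat.exists_eq_add_of_le' hd
        simp only [Finset.sum_const, Finset.card_univ, Fintype.card_fin, smul_eq_mul,
          Nat.add_sub_cancel]
        ring

/-! ### Hyperplanes with a good normal vector -/

lemma NoShortOrthogonal.ne_zero {n M : ℕ} (hn : 0 < n) (hM : 1 ≤ M) {z : Fin n → ℤ}
    (hz : NoShortOrthogonal M z) : z ≠ 0 := by
  rintro rfl
  refine hz (Pi.single ⟨0, hn⟩ 1) (by simp) (fun i => ?_) (zero_dotProduct _)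
  rw [Pi.single_apply]
  split_ifs <;> simp [hM]

/-- `NoShortOrthogonal` only depends on the line spanned by the vector. -/
lemma NoShortOrthogonal.of_mem_span {n M : ℕ} {z w : Fin n → ℤ} (hz : NoShortOrthogonal M z)
    (hw : w ≠ 0) (h : toEuc w ∈ Submodule.span ℝ {toEuc z}) : NoShortOrthogonal M w := by
  intro v hv hvM hwv
  refine hz v hv hvM ?_
  obtain ⟨t, ht⟩ := Submodule.mem_span_singleton.1 h
  have ht0 : t ≠ 0 := by
    rintro rfl
    rw [zero_smul, ← toEuc_zero] at ht
    exact hw (toEuc_injective ht).symm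
  have h1 := inner_toEuc w v
  rw [hwv, ← ht, real_inner_smul_left, inner_toEuc, Int.cast_zero] at h1
  exact_mod_cast (mul_eq_zero.1 h1).resolve_left ht0

/-- A vector orthogonal to no short integer vector is itself long: `x ↦ w ⬝ᵥ x` is injective on the
box `[0, M]ⁿ`. -/
lemma NoShortOrthogonal.le_norm {d M : ℕ} (hM : 1 ≤ M) {w : Fin (d + 1) → ℤ}
    (hw : NoShortOrthogonal M w) : (M : ℝ) ^ d ≤ 2 * (d + 1) * ‖toEuc w‖ := by
  obtain ⟨j, -, hj⟩ := Finset.exists_max_image Finset.univ (fun i => (w i).natAbs)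
    ⟨0, Finset.mem_univ _⟩
  obtain ⟨T, hT, hTw, hcard⟩ := exists_large_fiber (L := M) (N := (w j).natAbs) (z := w)
    fun i => by rw [Int.abs_eq_natAbs]; exact_mod_cast hj i (Finset.mem_univ _)
  have hT1 : T.card ≤ 1 := by
    refine Finset.card_le_one.2 fun x hx y hy => ?_
    by_contra hxy
    refine hw (x - y) (sub_ne_zero.2 hxy) (fun i => ?_) ?_
    · have h1 := hT x hx i
      have h2 := hT y hy i
      rw [Pi.sub_apply, abs_le]; omega
    · rw [dotProduct_sub, hTw x hx y hy, sub_self]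
  have h1 : M ^ (d + 1) < (M + 1) ^ (d + 1) := Nat.pow_lt_pow_left (by omega) (by omega)
  have h2 : (M + 1) ^ (d + 1) ≤ 2 * (d + 1) * (w j).natAbs * M + 1 :=
    hcard.trans ((Nat.mul_le_mul_left _ hT1).trans (mul_one _).le)
  have h3 : M ^ d * M ≤ 2 * (d + 1) * (w j).natAbs * M := by rw [← pow_succ]; omega
  have h4 : M ^ d ≤ 2 * (d + 1) * (w j).natAbs := Nat.le_of_mul_le_mul_right h3 hM
  calc (M : ℝ) ^ d ≤ 2 * (d + 1) * ((w j).natAbs : ℝ) := by exact_mod_cast h4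
    _ ≤ 2 * (d + 1) * ‖toEuc w‖ := by
      have : ((w j).natAbs : ℝ) = |(w j : ℝ)| := by
        rw [← Int.cast_abs, ← Int.natCast_natAbs, Int.cast_natCast]
      rw [this]
      gcongr
      exact abs_apply_le_norm_toEuc w j

/-- The short integer vectors orthogonal to `z` span the hyperplane `zᗮ`. If they only spanned a
proper subspace `W` of it, a large fiber of `x ↦ z ⬝ᵥ x` on the box `[0, K * M]ⁿ` would lie in a
translate of `W` and have mutual distances at least `M`, against the packing bound in `W`. -/
lemma NoShortOrthogonal.orthogonal_mem_latticeHyperplanes {d A M : ℕ} (hd : 1 ≤ d) (hA : 1 ≤ A)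
    (hM : 1 ≤ M) {z : Fin (d + 1) → ℤ} (hz : NoShortOrthogonal M z)
    (hzN : ∀ i, |z i| ≤ (A * M ^ d : ℕ)) {r : ℝ}
    (hr : ((d + 1 : ℕ) : ℝ) * (A * (3 * (d + 1)) ^ d * M : ℕ) ≤ r) :
    (Submodule.span ℝ {toEuc z})ᗮ ∈ latticeHyperplanes (d + 1) r := by
  set K := A * (3 * (d + 1)) ^ d with hK
  have hK1 : 1 ≤ K := Nat.mul_pos hA (Nat.pow_pos (by omega))
  set L := K * M with hL
  have hL1 : 1 ≤ L := Nat.mul_pos hK1 hM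
  set N := A * M ^ d with hN
  have hN1 : 1 ≤ N := Nat.mul_pos hA (Nat.pow_pos hM)
  set S : Set (EuclideanSpace ℝ (Fin (d + 1))) :=
    toEuc '' {x | (∀ i, |x i| ≤ L) ∧ z ⬝ᵥ x = 0} with hS
  set W := Submodule.span ℝ S with hWdef
  have hz0 : toEuc z ≠ 0 := fun h => hz.ne_zero (Nat.succ_pos d) hM (toEuc_injective (by
    rw [h, toEuc_zero]))
  have : Fact (finrank ℝ (EuclideanSpace ℝ (Fin (d + 1))) = d + 1) := ⟨by simp⟩
  have hfr : finrank ℝ (Submodule.span ℝ {toEuc z})ᗮ = d :=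
    Submodule.finrank_orthogonal_span_singleton hz0
  have hWle : W ≤ (Submodule.span ℝ {toEuc z})ᗮ := by
    rw [hWdef, Submodule.span_le]
    rintro _ ⟨x, ⟨-, hx⟩, rfl⟩
    rw [SetLike.mem_coe, Submodule.mem_orthogonal_singleton_iff_inner_right, inner_toEuc, hx,
      Int.cast_zero]
  have hWd : finrank ℝ W = d := by
    refine le_antisymm ((Submodule.finrank_mono hWle).trans hfr.le) ?_
    by_contra! hlt
    obtain ⟨T, hT, hTz, hcard⟩ := exists_large_fiber (L := L) (N := N) hzN
    have hTabs : ∀ x ∈ T, ∀ y ∈ T, ∀ i, |(x - y) i| ≤ L := fun x hx y hy i => by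
      have h1 := hT x hx i
      have h2 := hT y hy i
      rw [Pi.sub_apply, abs_le]; omega
    have hTo : ∀ x ∈ T, ∀ y ∈ T, z ⬝ᵥ (x - y) = 0 := fun x hx y hy => by
      rw [dotProduct_sub, hTz x hx y hy, sub_self]
    have hM0 : (0 : ℝ) < M := by exact_mod_cast hM
    have hpack := card_le_of_separated_of_sub_mem W (R := (d + 1 : ℕ) * L) (δ := M) hM0
      (by positivity) (T.map ⟨toEuc, toEuc_injective⟩)
      (by
        simp only [Finset.mem_map, Function.Embedding.coeFn_mk, forall_exists_index, and_imp]
        rintro _ x hx rfl _ y hy rfl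
        rw [← toEuc_sub]
        exact Submodule.subset_span ⟨x - y, ⟨hTabs x hx y hy, hTo x hx y hy⟩, rfl⟩)
      (by
        simp only [Finset.mem_map, Function.Embedding.coeFn_mk, forall_exists_index, and_imp]
        rintro _ x hx rfl _ y hy rfl
        rw [← toEuc_sub]
        exact norm_toEuc_le (hTabs x hx y hy))
      (by
        simp only [Finset.mem_map, Function.Embedding.coeFn_mk, forall_exists_index, and_imp]
        rintro _ x hx rfl _ y hy rfl hxy
        rw [← toEuc_sub]
        have hxy' : x - y ≠ 0 := sub_ne_zero.2 fun h => hxy (by rw [h])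
        by_contra! hlt
        refine hz (x - y) hxy' (fun i => ?_) (hTo x hx y hy)
        exact_mod_cast (abs_apply_le_norm_toEuc (x - y) i).trans hlt.le)
    have hbase : 1 + 2 * (((d + 1 : ℕ) : ℝ) * L) / M = ((1 + 2 * (d + 1) * K : ℕ) : ℝ) := by
      rw [hL]; push_cast; field_simp
    rw [Finset.card_map, hbase] at hpack
    have hpack' : T.card ≤ (3 * (d + 1) * K) ^ (d - 1) := by
      have h1 : T.card ≤ (1 + 2 * (d + 1) * K) ^ finrank ℝ W := by exact_mod_cast hpack
      have h3 : 1 ≤ (d + 1) * K := Nat.mul_pos (Nat.succ_pos d) hK1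
      have h2 : 1 + 2 * (d + 1) * K ≤ 3 * (d + 1) * K := by
        rw [mul_assoc, mul_assoc]; omega
      exact h1.trans ((Nat.pow_le_pow_left h2 _).trans
        (Nat.pow_le_pow_right (by rw [mul_assoc]; omega) (by omega)))
    have h1 : L ^ (d + 1) < (L + 1) ^ (d + 1) := Nat.pow_lt_pow_left (by omega) (by omega)
    have h2 : 2 * (d + 1) * N * L + 1 ≤ 3 * (d + 1) * N * L := by
      have : 1 ≤ (d + 1) * (N * L) := Nat.mul_pos (Nat.succ_pos d) (Nat.mul_pos hN1 hL1)
      simp only [mul_assoc]; omega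
    have h3 := h1.trans_le (hcard.trans (Nat.mul_le_mul h2 hpack'))
    -- `K` is chosen so that the strict inequality `h3` between the two counts is an equality.
    refine h3.ne ?_
    obtain ⟨e, rfl⟩ := Nat.exists_eq_add_of_le' hd
    rw [hN, hL, Nat.add_sub_cancel]
    calc (K * M) ^ (e + 1 + 1) = K * (K ^ (e + 1) * M ^ (e + 2)) := by
          rw [mul_pow, pow_succ' K, mul_assoc]
      _ = (A * (3 * (e + 1 + 1)) ^ (e + 1)) * (K ^ (e + 1) * M ^ (e + 2)) := by rw [← hK]
      _ = _ := by generalize 3 * (e + 1 + 1) = m; simp only [mul_pow]; ring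
  have hWeq : W = (Submodule.span ℝ {toEuc z})ᗮ :=
    Submodule.eq_of_le_of_finrank_eq hWle (hWd.trans hfr.symm)
  obtain ⟨f, hfS, -, hf⟩ := Submodule.exists_fun_fin_finrank_span_eq ℝ S
  have hcast : d + 1 - 1 = finrank ℝ (Submodule.span ℝ S) := hWd.symm
  refine ⟨by rw [hfr], f ∘ Fin.cast hcast, hf.comp _ (Fin.cast_injective hcast), fun i => ?_⟩
  refine ⟨hWeq ▸ Submodule.subset_span (hfS _), ?_⟩
  obtain ⟨x, ⟨hx, -⟩, hxf⟩ := hfS (Fin.cast hcast i)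
  rw [Function.comp_apply, ← hxf]
  exact ⟨toEuc_mem_integerLattice x, mem_closedBall_zero_iff.2 ((norm_toEuc_le hx).trans hr)⟩

/-- Boundedly many vectors `z` of the box define the same hyperplane: by
`NoShortOrthogonal.le_norm` their differences are long, and they all lie on one line. -/
lemma card_le_of_orthogonal_eq {d A M : ℕ} (hM : 1 ≤ M)
    {H : Submodule ℝ (EuclideanSpace ℝ (Fin (d + 1)))} (s : Finset (Fin (d + 1) → ℤ))
    (hs : ∀ z ∈ s, NoShortOrthogonal M z ∧ (∀ i, |z i| ≤ (A * M ^ d : ℕ)) ∧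
      (Submodule.span ℝ {toEuc z})ᗮ = H) :
    s.card ≤ 1 + 8 * (d + 1) ^ 2 * A := by
  have hM0 : (0 : ℝ) < M := by exact_mod_cast hM
  have hspan : ∀ z ∈ s, Submodule.span ℝ {toEuc z} = Hᗮ := fun z hz => by
    rw [← (hs z hz).2.2, Submodule.orthogonal_orthogonal]
  have hmem : ∀ z ∈ s, toEuc z ∈ Hᗮ := fun z hz => by
    rw [← hspan z hz]; exact Submodule.mem_span_singleton_self _
  rcases s.eq_empty_or_nonempty with rfl | ⟨p, hp⟩
  · simp
  have hline : finrank ℝ Hᗮ ≤ 1 := by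
    rw [← hspan p hp]
    exact (finrank_span_le_card _).trans (by simp)
  have hpack := card_le_of_separated_of_sub_mem Hᗮ (R := (d + 1 : ℕ) * (2 * (A * M ^ d) : ℕ))
    (δ := (M : ℝ) ^ d / (2 * (d + 1))) (by positivity) (by positivity)
    (s.map ⟨toEuc, toEuc_injective⟩)
    (by
      simp only [Finset.mem_map, Function.Embedding.coeFn_mk, forall_exists_index, and_imp]
      rintro _ x hx rfl _ y hy rfl
      exact Submodule.sub_mem _ (hmem x hx) (hmem y hy))
    (by
      simp only [Finset.mem_map, Function.Embedding.coeFn_mk, forall_exists_index, and_imp]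
      rintro _ x hx rfl _ y hy rfl
      rw [← toEuc_sub]
      refine norm_toEuc_le fun i => ?_
      have h1 := abs_le.1 ((hs x hx).2.1 i)
      have h2 := abs_le.1 ((hs y hy).2.1 i)
      rw [Pi.sub_apply, abs_le, Nat.cast_mul 2]
      constructor <;> push_cast at * <;> linarith)
    (by
      simp only [Finset.mem_map, Function.Embedding.coeFn_mk, forall_exists_index, and_imp]
      rintro _ x hx rfl _ y hy rfl hxy
      rw [← toEuc_sub, div_le_iff₀' (by positivity)]
      refine ((hs x hx).1.of_mem_span (sub_ne_zero.2 fun h => hxy (by rw [h])) ?_).le_norm hM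
      rw [toEuc_sub, hspan x hx]
      exact Submodule.sub_mem _ (hmem x hx) (hmem y hy))
  have hbase : 1 + 2 * (((d + 1 : ℕ) : ℝ) * (2 * (A * M ^ d) : ℕ)) / ((M : ℝ) ^ d / (2 * (d + 1)))
      = ((1 + 8 * (d + 1) ^ 2 * A : ℕ) : ℝ) := by
    push_cast; field_simp; ring
  rw [Finset.card_map, hbase] at hpack
  have h1 : s.card ≤ (1 + 8 * (d + 1) ^ 2 * A) ^ finrank ℝ Hᗮ := by exact_mod_cast hpack
  simpa using h1.trans (Nat.pow_le_pow_right (by omega) hline)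

/-! ### Counting the hyperplanes -/

/-- The lower bound in terms of an integer scale `M`. -/
lemma pow_le_mul_ncard_latticeHyperplanes {d A M : ℕ} (hd : 1 ≤ d) (hA : A = (d + 1) * 9 ^ d)
    (hM : 1 ≤ M) {r : ℝ} (hr : ((d + 1 : ℕ) : ℝ) * (A * (3 * (d + 1)) ^ d * M : ℕ) ≤ r)
    (hfin : (latticeHyperplanes (d + 1) r).Finite) :
    M ^ ((d + 1) * d) ≤ (1 + 8 * (d + 1) ^ 2 * A) * (latticeHyperplanes (d + 1) r).ncard := by
  classical
  have hA1 : 1 ≤ A := hA ▸ Nat.mul_pos (Nat.succ_pos d) (Nat.pow_pos (by omega))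
  set N := A * M ^ d with hN
  have hMN : M ≤ N := (Nat.le_self_pow (by omega) M).trans (Nat.le_mul_of_pos_left _ hA1)
  set B : Finset (Fin (d + 1) → ℤ) := Fintype.piFinset fun _ => Finset.Icc (-N : ℤ) N with hB
  have hBcard : B.card = (2 * N + 1) ^ (d + 1) := by
    have : ((N : ℤ) + 1 + N).toNat = 2 * N + 1 := by omega
    simp [hB, this]
  have hbad : (B.filter fun z => ¬ NoShortOrthogonal M z).card ≤ N ^ (d + 1) := by
    refine (card_not_noShortOrthogonal_le hd hMN).trans (le_of_eq ?_)
    rw [← hA, ← hN]; ring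
  have hgood : N ^ (d + 1) ≤ (B.filter fun z => NoShortOrthogonal M z).card := by
    have h1 := B.card_filter_add_card_filter_not (fun z => NoShortOrthogonal M z)
    have h2 : 2 * N ^ (d + 1) ≤ (2 * N + 1) ^ (d + 1) :=
      calc 2 * N ^ (d + 1) ≤ 2 ^ (d + 1) * N ^ (d + 1) :=
            Nat.mul_le_mul_right _ (Nat.le_self_pow (by omega) 2)
        _ = (2 * N) ^ (d + 1) := (mul_pow _ _ _).symm
        _ ≤ _ := Nat.pow_le_pow_left (by omega) _
    omega
  have hmem : ∀ z ∈ B.filter fun z => NoShortOrthogonal M z,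
      NoShortOrthogonal M z ∧ ∀ i, |z i| ≤ (A * M ^ d : ℕ) := fun z hz => by
    simp only [hB, Finset.mem_filter, Fintype.mem_piFinset, Finset.mem_Icc, ← abs_le] at hz
    exact ⟨hz.2, hz.1⟩
  calc M ^ ((d + 1) * d) = (M ^ d) ^ (d + 1) := by rw [← pow_mul, mul_comm]
    _ ≤ N ^ (d + 1) := Nat.pow_le_pow_left (Nat.le_mul_of_pos_left _ hA1) _
    _ ≤ (B.filter fun z => NoShortOrthogonal M z).card := hgood
    _ ≤ (1 + 8 * (d + 1) ^ 2 * A) * hfin.toFinset.card := by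
      refine Finset.card_le_mul_card_image_of_maps_to
        (f := fun z => (Submodule.span ℝ {toEuc z})ᗮ) (fun z hz => ?_) _ fun H _ => ?_
      · obtain ⟨h1, h2⟩ := hmem z hz
        exact hfin.mem_toFinset.2 (h1.orthogonal_mem_latticeHyperplanes hd hA1 hM h2 hr)
      · refine card_le_of_orthogonal_eq (H := H) hM _ fun z hz => ?_
        obtain ⟨hz, hzH⟩ := Finset.mem_filter.1 hz
        exact ⟨(hmem z hz).1, (hmem z hz).2, hzH⟩
    _ = _ := by rw [Set.ncard_eq_toFinset_card _ hfin]

/-- Each hyperplane counted is the span of some `n - 1` lattice points of the ball. -/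
lemma finite_latticeHyperplanes_and_ncard_le (n : ℕ) {r : ℝ} (hr : 1 ≤ r) :
    (latticeHyperplanes n r).Finite ∧
      ((latticeHyperplanes n r).ncard : ℝ) ≤ 3 ^ (n * (n - 1)) * r ^ (n * (n - 1)) := by
  classical
  set B : Finset (Fin (n - 1) → Fin n → ℤ) := Fintype.piFinset fun _ =>
    Fintype.piFinset fun _ => Finset.Icc (-⌊r⌋₊ : ℤ) ⌊r⌋₊ with hB
  have hBcard : B.card = (2 * ⌊r⌋₊ + 1) ^ (n * (n - 1)) := by
    have : ((⌊r⌋₊ : ℤ) + 1 + ⌊r⌋₊).toNat = 2 * ⌊r⌋₊ + 1 := by omega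
    simp only [hB, Fintype.card_piFinset_const, Int.card_Icc, sub_neg_eq_add, this, ← pow_mul]
  let f : (Fin (n - 1) → Fin n → ℤ) → Submodule ℝ (EuclideanSpace ℝ (Fin n)) := fun t =>
    Submodule.span ℝ (Set.range fun i => toEuc (t i))
  have hsub : latticeHyperplanes n r ⊆ (B.image f : Finset _) := by
    rintro H ⟨hH, v, hv, hvH⟩
    choose x hx using fun i => exists_toEuc_eq (hvH i).2.1
    have hxv : (fun i => toEuc (x i)) = v := funext hx
    rw [Finset.mem_coe, Finset.mem_image]
    refine ⟨x, ?_, ?_⟩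
    · simp only [hB, Fintype.mem_piFinset, Finset.mem_Icc, ← abs_le]
      intro i j
      have h1 : (|x i j| : ℝ) ≤ r := (abs_apply_le_norm_toEuc (x i) j).trans
        (by rw [hx i]; exact mem_closedBall_zero_iff.1 (hvH i).2.2)
      have h2 : (x i j).natAbs ≤ ⌊r⌋₊ := Nat.le_floor (by
        rw [← Int.cast_abs, ← Int.natCast_natAbs, Int.cast_natCast] at h1; exact h1)
      rw [Int.abs_eq_natAbs]
      exact_mod_cast h2
    · simp only [f, hxv]
      refine Submodule.eq_of_le_of_finrank_eq ?_ ?_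
      · rw [Submodule.span_le]
        rintro _ ⟨i, rfl⟩
        exact (hvH i).1
      · rw [finrank_span_eq_card hv, Fintype.card_fin]
        omega
  refine ⟨(Finset.finite_toSet _).subset hsub, ?_⟩
  have h1 : (latticeHyperplanes n r).ncard ≤ (2 * ⌊r⌋₊ + 1) ^ (n * (n - 1)) := by
    refine (Set.ncard_le_ncard hsub (Finset.finite_toSet _)).trans ?_
    rw [Set.ncard_coe_finset, ← hBcard]
    exact Finset.card_image_le
  calc ((latticeHyperplanes n r).ncard : ℝ) ≤ (2 * ⌊r⌋₊ + 1 : ℝ) ^ (n * (n - 1)) := by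
        exact_mod_cast h1
    _ ≤ (3 * r) ^ (n * (n - 1)) := by
        have := Nat.floor_le (zero_le_one.trans hr)
        gcongr
        linarith
    _ = _ := mul_pow _ _ _

theorem theorem3 (n : ℕ) (hn : 1 ≤ n) :
    ∃ c₁ c₂ : ℝ, 0 < c₁ ∧ 0 < c₂ ∧ ∃ R : ℝ, ∀ r : ℝ, R ≤ r →
      (latticeHyperplanes n r).Finite ∧
      c₁ * r ^ (n * (n - 1)) ≤ ((latticeHyperplanes n r).ncard : ℝ) ∧
      ((latticeHyperplanes n r).ncard : ℝ) ≤ c₂ * r ^ (n * (n - 1)) := by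
  obtain ⟨d, rfl⟩ := Nat.exists_eq_add_of_le' hn
  rcases Nat.eq_zero_or_pos d with rfl | hd
  · -- In dimension one the only hyperplane is the zero subspace, and it is always counted.
    refine ⟨1, 3 ^ ((0 + 1) * (0 + 1 - 1)), one_pos, by positivity, 1, fun r hr => ?_⟩
    obtain ⟨hfin, hle⟩ := finite_latticeHyperplanes_and_ncard_le (0 + 1) hr
    refine ⟨hfin, ?_, hle⟩
    have hne : (latticeHyperplanes (0 + 1) r).Nonempty := by
      have : IsEmpty (Fin (0 + 1 - 1)) := Fin.isEmpty
      exact ⟨⊥, by simp, isEmptyElim, linearIndependent_empty_type, isEmptyElim⟩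
    have h1 : 1 ≤ (latticeHyperplanes (0 + 1) r).ncard := (Set.ncard_pos hfin).2 hne
    simpa using h1
  · obtain ⟨A, hA⟩ : ∃ A, A = (d + 1) * 9 ^ d := ⟨_, rfl⟩
    have hA1 : 1 ≤ A := hA ▸ Nat.mul_pos (Nat.succ_pos d) (Nat.pow_pos (by omega))
    obtain ⟨C, hC⟩ : ∃ C : ℕ, C = (d + 1) * (A * (3 * (d + 1)) ^ d) := ⟨_, rfl⟩
    have hC1 : 1 ≤ C := hC ▸ Nat.mul_pos (Nat.succ_pos d)
      (Nat.mul_pos hA1 (Nat.pow_pos (by omega)))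
    have hC0 : (1 : ℝ) ≤ C := by exact_mod_cast hC1
    set Q : ℕ := 1 + 8 * (d + 1) ^ 2 * A with hQ
    have hQ0 : (0 : ℝ) < Q := by exact_mod_cast (by omega : 0 < Q)
    refine ⟨1 / (Q * (2 * C) ^ ((d + 1) * d)), 3 ^ ((d + 1) * (d + 1 - 1)), by positivity,
      by positivity, C, fun r hr => ?_⟩
    obtain ⟨hfin, hle⟩ := finite_latticeHyperplanes_and_ncard_le (d + 1) (hC0.trans hr)
    refine ⟨hfin, ?_, hle⟩
    have hrC : 1 ≤ r / C := (one_le_div (by positivity)).2 hr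
    have hM1 : 1 ≤ ⌊r / C⌋₊ := Nat.le_floor (by exact_mod_cast hrC)
    have hMr : C * (⌊r / C⌋₊ : ℝ) ≤ r := by
      rw [← le_div_iff₀' (by positivity)]
      exact Nat.floor_le (zero_le_one.trans hrC)
    have hrM : r ≤ 2 * C * (⌊r / C⌋₊ : ℝ) := by
      have h1 := Nat.lt_floor_add_one (r / C)
      have h2 : (1 : ℝ) ≤ ⌊r / C⌋₊ := by exact_mod_cast hM1
      have h3 : r / C ≤ 2 * (⌊r / C⌋₊ : ℝ) := by linarith
      rw [div_le_iff₀ (by positivity)] at h3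
      linarith
    have hmain := pow_le_mul_ncard_latticeHyperplanes hd hA hM1 (r := r)
      (by refine le_trans (le_of_eq ?_) hMr; rw [hC]; push_cast; ring) hfin
    have hmain' : (⌊r / C⌋₊ : ℝ) ^ ((d + 1) * d) ≤
        Q * ((latticeHyperplanes (d + 1) r).ncard : ℝ) := by exact_mod_cast hmain
    rw [Nat.add_sub_cancel, one_div, inv_mul_le_iff₀ (by positivity)]
    calc r ^ ((d + 1) * d) ≤ (2 * C * (⌊r / C⌋₊ : ℝ)) ^ ((d + 1) * d) :=
          pow_le_pow_left₀ (by linarith) hrM _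
      _ = (2 * C) ^ ((d + 1) * d) * (⌊r / C⌋₊ : ℝ) ^ ((d + 1) * d) := mul_pow _ _ _
      _ ≤ (2 * C) ^ ((d + 1) * d) * (Q * ((latticeHyperplanes (d + 1) r).ncard : ℝ)) := by
          gcongr
      _ = _ := by ring
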